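/- **Proposition 1 (Continuous inf-sup and infinity conditions).** Let $d\ge 1$ be an integer and let $\Omega\subset\mathbb R^d$ be a bounded open set. Let $(\cdot,\cdot)$ and $\|\cdot\|_0$ denote the scalar product and norm of $L^2(\Omega)$ and of $(L^2(\Omega))^d$ (real-valued functions). Let $H(\mathrm{div},\Omega)$ be the space of vector fields $q=(q_1,\dots,q_d)\in (L^2(\Omega))^d$ whose divergence $\mathrm{div}\,q=\sum_{j=1}^d \partial q_j/\partial x_j$, in the sense of distributions, belongs to $L^2(\Omega)$. Let $V=L^2(\Omega)\times H(\mathrm{div},\Omega)$ with the norm $$\|(v,q)\|_V=\bigl(\|v\|_0^2+\|q\|_0^2+\|\mathrm{div}\,q\|_0^2\bigr)^{1/2},$$ and let $\gamma:V\times V\to\mathbb R$ be the bilinear form $$\gamma\bigl((u,p),(v,q)\bigr)=(p,q)+(u,\mathrm{div}\,q)+(\mathrm{div}\,p,v).$$ Then both of the following hold. 1. (Inf-sup condition) There exists $\beta>0$ such that $$\inf_{\|\xi\|_V=1}\ \sup_{\|\eta\|_V\le 1}\gamma(\xi,\eta)\ \ge\ \beta .$$ 2. (Infinity condition) For every $\eta\in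 V$ with $\eta\neq 0$, $\ \sup_{\xi\in V}\gamma(\xi,\eta)=+\infty$. (The infimum and suprema are taken in $[-\infty,+\infty]$.) -/

import Mathlib

noncomputable section

namespace MixedPoisson

open MeasureTheory TopologicalSpace
open scoped ContDiff

/-- The Euclidean space `ℝ^d`. -/
abbrev E (d : ℕ) : Type := EuclideanSpace ℝ (Fin d)

/-- `L²(Ω)`, real valued functions, for the Lebesgue measure on `Ω`. -/
abbrev L2 {d : ℕ} (Ω : Opens (E d)) : Type :=
  Lp ℝ 2 (volume.restrict (Ω : Set (E d)))

/-- `(L²(Ω))^d`: square integrable vector fields on `Ω`; since `ℝ^d` carries the Euclidean norm,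
the square of the norm is `∑ j, ‖q_j‖₀²`. -/
abbrev L2Vec {d : ℕ} (Ω : Opens (E d)) : Type :=
  Lp (E d) 2 (volume.restrict (Ω : Set (E d)))

/-- Test functions on `Ω`: real valued, smooth, with compact support contained in `Ω`. -/
structure IsTestFunction {d : ℕ} (Ω : Opens (E d)) (φ : E d → ℝ) : Prop where
  smooth : ContDiff ℝ ∞ φ
  compact : HasCompactSupport φ
  support : tsupport φ ⊆ (Ω : Set (E d))

/-- `g` is the divergence of `q` in the sense of distributions on `Ω`:
`∫_Ω ∑ j, q_j ∂φ/∂x_j = - ∫_Ω g φ` for every test function `φ`. -/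
def HasWeakDiv {d : ℕ} (Ω : Opens (E d)) (q : L2Vec Ω) (g : L2 Ω) : Prop :=
  ∀ φ : E d → ℝ, IsTestFunction Ω φ →
    ∫ x in (Ω : Set (E d)), ∑ j : Fin d, q x j * fderiv ℝ φ x (EuclideanSpace.single j 1)
      = - ∫ x in (Ω : Set (E d)), g x * φ x

theorem IsTestFunction.memLp {d : ℕ} {Ω : Opens (E d)} {φ : E d → ℝ}
    (hφ : IsTestFunction Ω φ) : MemLp φ 2 (volume.restrict (Ω : Set (E d))) :=
  (hφ.smooth.continuous.memLp_of_hasCompactSupport hφ.compact).restrict _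

theorem IsTestFunction.integrable_mul {d : ℕ} {Ω : Opens (E d)} {φ : E d → ℝ}
    (hφ : IsTestFunction Ω φ) (g : L2 Ω) :
    Integrable (fun x => g x * φ x) (volume.restrict (Ω : Set (E d))) :=
  (Lp.memLp g).integrable_mul hφ.memLp

theorem IsTestFunction.integrable_fderiv {d : ℕ} {Ω : Opens (E d)} {φ : E d → ℝ}
    (hφ : IsTestFunction Ω φ) (q : L2Vec Ω) :
    Integrable (fun x => ∑ j : Fin d, q x j * fderiv ℝ φ x (EuclideanSpace.single j 1))
      (volume.restrict (Ω : Set (E d))) := by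
  refine integrable_finsetSum _ fun j _ => ?_
  have h1 : MemLp (fun x => q x j) 2 (volume.restrict (Ω : Set (E d))) :=
    (EuclideanSpace.proj (𝕜 := ℝ) j).comp_memLp' (Lp.memLp q)
  have hc : Continuous (fderiv ℝ φ) := hφ.smooth.continuous_fderiv (by simp)
  have hs : HasCompactSupport (fderiv ℝ φ) := hφ.compact.fderiv ℝ
  have h2 : MemLp (fun x => fderiv ℝ φ x (EuclideanSpace.single j 1)) 2
      (volume.restrict (Ω : Set (E d))) :=
    ((hc.clm_apply continuous_const).memLp_of_hasCompactSupport
      (hs.mono fun x hx h => hx (by simp [h]))).restrict _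
  exact h1.integrable_mul h2

theorem HasWeakDiv.add {d : ℕ} {Ω : Opens (E d)} {q q' : L2Vec Ω} {g g' : L2 Ω}
    (h : HasWeakDiv Ω q g) (h' : HasWeakDiv Ω q' g') : HasWeakDiv Ω (q + q') (g + g') := by
  intro φ hφ
  have e1 : ∫ x in (Ω : Set (E d)),
      ∑ j : Fin d, (q + q') x j * fderiv ℝ φ x (EuclideanSpace.single j 1)
      = ∫ x in (Ω : Set (E d)),
        ((∑ j : Fin d, q x j * fderiv ℝ φ x (EuclideanSpace.single j 1))
          + ∑ j : Fin d, q' x j * fderiv ℝ φ x (EuclideanSpace.single j 1)) := by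
    refine integral_congr_ae ?_
    filter_upwards [Lp.coeFn_add q q'] with x hx
    simp only [hx, Pi.add_apply, PiLp.add_apply, add_mul, Finset.sum_add_distrib]
  have e2 : ∫ x in (Ω : Set (E d)), (g + g') x * φ x
      = ∫ x in (Ω : Set (E d)), (g x * φ x + g' x * φ x) := by
    refine integral_congr_ae ?_
    filter_upwards [Lp.coeFn_add g g'] with x hx
    simp only [hx, Pi.add_apply, add_mul]
  rw [e1, e2, integral_add (hφ.integrable_fderiv q) (hφ.integrable_fderiv q'),
    integral_add (hφ.integrable_mul g) (hφ.integrable_mul g'), h φ hφ, h' φ hφ]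
  ring

theorem HasWeakDiv.smul {d : ℕ} {Ω : Opens (E d)} {q : L2Vec Ω} {g : L2 Ω}
    (c : ℝ) (h : HasWeakDiv Ω q g) : HasWeakDiv Ω (c • q) (c • g) := by
  intro φ hφ
  have e1 : ∫ x in (Ω : Set (E d)),
      ∑ j : Fin d, (c • q) x j * fderiv ℝ φ x (EuclideanSpace.single j 1)
      = ∫ x in (Ω : Set (E d)),
        c * ∑ j : Fin d, q x j * fderiv ℝ φ x (EuclideanSpace.single j 1) := by
    refine integral_congr_ae ?_
    filter_upwards [Lp.coeFn_smul c q] with x hx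
    simp [hx, Finset.mul_sum, mul_assoc]
  have e2 : ∫ x in (Ω : Set (E d)), (c • g) x * φ x
      = ∫ x in (Ω : Set (E d)), c * (g x * φ x) := by
    refine integral_congr_ae ?_
    filter_upwards [Lp.coeFn_smul c g] with x hx
    simp [hx, mul_assoc]
  rw [e1, e2, integral_const_mul, integral_const_mul, h φ hφ]
  ring

theorem hasWeakDiv_zero {d : ℕ} (Ω : Opens (E d)) : HasWeakDiv Ω 0 0 := by
  intro φ _
  have e1 : ∫ x in (Ω : Set (E d)),
      ∑ j : Fin d, (0 : L2Vec Ω) x j * fderiv ℝ φ x (EuclideanSpace.single j 1) = 0 := by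
    refine integral_eq_zero_of_ae ?_
    filter_upwards [Lp.coeFn_zero (E d) 2 (volume.restrict (Ω : Set (E d)))] with x hx
    simp only [hx, Pi.zero_apply, PiLp.zero_apply, zero_mul, Finset.sum_const_zero]
  have e2 : ∫ x in (Ω : Set (E d)), (0 : L2 Ω) x * φ x = 0 := by
    refine integral_eq_zero_of_ae ?_
    filter_upwards [Lp.coeFn_zero ℝ 2 (volume.restrict (Ω : Set (E d)))] with x hx
    simp only [hx, Pi.zero_apply, zero_mul]
  rw [e1, e2, neg_zero]

/-- The divergence in the sense of distributions is unique. -/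
theorem HasWeakDiv.unique {d : ℕ} {Ω : Opens (E d)} {q : L2Vec Ω} {g g' : L2 Ω}
    (h : HasWeakDiv Ω q g) (h' : HasWeakDiv Ω q g') : g = g' := by
  apply Lp.ext
  have hloc : ∀ f : L2 Ω, LocallyIntegrableOn f (Ω : Set (E d)) volume := fun f =>
    locallyIntegrableOn_of_locallyIntegrable_restrict
      ((Lp.memLp f).locallyIntegrable (by norm_num))
  have key : ∀ᵐ x ∂(volume : Measure (E d)), x ∈ (Ω : Set (E d)) → (g x - g' x) = 0 := by
    refine Ω.isOpen.ae_eq_zero_of_integral_contDiff_smul_eq_zero ((hloc g).sub (hloc g')) ?_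
    intro φ hs hc hsup
    have hφ : IsTestFunction Ω φ := ⟨hs, hc, hsup⟩
    have e : ∫ x in (Ω : Set (E d)), (g x * φ x - g' x * φ x) = 0 := by
      rw [integral_sub (hφ.integrable_mul g) (hφ.integrable_mul g')]
      have := (h φ hφ).symm.trans (h' φ hφ)
      linarith
    rw [← e, ← setIntegral_eq_integral_of_forall_compl_eq_zero (s := (Ω : Set (E d)))]
    · refine integral_congr_ae (Filter.Eventually.of_forall fun x => ?_)
      simp only [smul_eq_mul]
      ring
    · intro x hx
      have : φ x = 0 := by
        by_contra hne
        exact hx (hsup (subset_tsupport φ hne))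
      simp [this]
  rw [Filter.EventuallyEq, ae_restrict_iff' Ω.isOpen.measurableSet]
  filter_upwards [key] with x hx hxΩ
  exact sub_eq_zero.mp (hx hxΩ)

/-- `H(div, Ω)`: the vector fields in `(L²(Ω))^d` whose distributional divergence is in `L²(Ω)`.
(The norm of this space is `normDiv` below, not the `L²` norm.) -/
def HDiv {d : ℕ} (Ω : Opens (E d)) : Submodule ℝ (L2Vec Ω) where
  carrier := {q | ∃ g : L2 Ω, HasWeakDiv Ω q g}
  add_mem' := by
    rintro q q' ⟨g, hg⟩ ⟨g', hg'⟩
    exact ⟨g + g', hg.add hg'⟩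
  zero_mem' := ⟨0, hasWeakDiv_zero Ω⟩
  smul_mem' := by
    rintro c q ⟨g, hg⟩
    exact ⟨c • g, hg.smul c⟩

/-- The divergence `div : H(div, Ω) → L²(Ω)`. -/
def div {d : ℕ} {Ω : Opens (E d)} : HDiv Ω →ₗ[ℝ] L2 Ω where
  toFun q := q.2.choose
  map_add' p q :=
    HasWeakDiv.unique (p + q).2.choose_spec (p.2.choose_spec.add q.2.choose_spec)
  map_smul' c q := HasWeakDiv.unique (c • q).2.choose_spec (q.2.choose_spec.smul c)

theorem hasWeakDiv_div {d : ℕ} {Ω : Opens (E d)} (q : HDiv Ω) :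
    HasWeakDiv Ω (q : L2Vec Ω) (div q) :=
  q.2.choose_spec

/-- The norm of `H(div, Ω)`. -/
def normDiv {d : ℕ} {Ω : Opens (E d)} (q : HDiv Ω) : ℝ :=
  Real.sqrt (‖(q : L2Vec Ω)‖ ^ 2 + ‖div q‖ ^ 2)

/-- The product space `V = L²(Ω) × H(div, Ω)`, with the norm `normV` below. -/
abbrev V {d : ℕ} (Ω : Opens (E d)) : Type := L2 Ω × HDiv Ω

/-- The norm of `V`: `‖(v, q)‖_V = (‖v‖₀² + ‖q‖_div²)^{1/2}`. -/
def normV {d : ℕ} {Ω : Opens (E d)} (η : V Ω) : ℝ :=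
  Real.sqrt (‖η.1‖ ^ 2 + normDiv η.2 ^ 2)

/-- The bilinear form `γ((u, p), (v, q)) = (p, q) + (u, div q) + (div p, v)`, where `( , )` are
the inner products of `(L²(Ω))^d` and `L²(Ω)`. -/
def γ {d : ℕ} (Ω : Opens (E d)) : V Ω →ₗ[ℝ] V Ω →ₗ[ℝ] ℝ :=
  LinearMap.mk₂ ℝ
    (fun ξ η => inner ℝ (ξ.2 : L2Vec Ω) (η.2 : L2Vec Ω) + inner ℝ ξ.1 (div η.2)
      + inner ℝ (div ξ.2) η.1)
    (by intros; simp only [Prod.fst_add, Prod.snd_add, Submodule.coe_add, map_add,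
          inner_add_left]; ring)
    (by intros; simp only [Prod.smul_fst, Prod.smul_snd, Submodule.coe_smul, map_smul,
          real_inner_smul_left, smul_eq_mul]; ring)
    (by intros; simp only [Prod.fst_add, Prod.snd_add, Submodule.coe_add, map_add,
          inner_add_right]; ring)
    (by intros; simp only [Prod.smul_fst, Prod.smul_snd, Submodule.coe_smul, map_smul,
          real_inner_smul_right, smul_eq_mul]; ring)

end MixedPoisson

end

namespace MixedPoisson

open MeasureTheory TopologicalSpace
open scoped ContDiff

/-! The crux is that the divergence maps `H(div, Ω)` onto `L²(Ω)` with a bounded right inverse. This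
is dual to the Poincaré inequality `‖φ‖ ≤ 2R ‖∇φ‖` for test functions: it makes `∇φ ↦ -(f, φ)` a
well-defined bounded functional on gradients, and Hahn–Banach and Riesz represent it by a field `q`
with `div q = f` (`exists_div_eq`).

Given `ξ = (u, p)`, choose `w` with `div w = u`. For small `t > 0`, testing against `(div p - u, p +
t w)` bounds `γ` below by a multiple of `‖ξ‖²` (`exists_le_γ`). Normalizing the test element gives
the inf-sup bound; symmetry of `γ` and scaling give the infinity condition. -/

/-- If `‖J t‖ ≤ C ‖G t‖` for all `t`, then `f ∘ J` is represented through `G` by a vector of norm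
at most `C ‖f‖`. -/
theorem exists_inner_eq_of_norm_le {T H K : Type*} [AddCommGroup T] [Module ℝ T]
    [NormedAddCommGroup H] [InnerProductSpace ℝ H] [CompleteSpace H]
    [NormedAddCommGroup K] [InnerProductSpace ℝ K]
    (G : T →ₗ[ℝ] H) (J : T →ₗ[ℝ] K) {C : ℝ} (hC : 0 ≤ C) (h : ∀ t, ‖J t‖ ≤ C * ‖G t‖) (f : K) :
    ∃ q : H, ‖q‖ ≤ C * ‖f‖ ∧ ∀ t, inner ℝ q (G t) = inner ℝ f (J t) := by
  -- `s` is a merely algebraic section of `G`; the bound on `J` is what makes `J ∘ s` continuous.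
  obtain ⟨s, hs⟩ := G.rangeRestrict.exists_rightInverse_of_surjective G.range_rangeRestrict
  have hs' : ∀ y : G.range, G (s y) = y := fun y =>
    congrArg Subtype.val (LinearMap.congr_fun hs y)
  let S : G.range →L[ℝ] K := (J ∘ₗ s).mkContinuous C fun y => by
    simpa [hs'] using h (s y)
  -- The choice of section is harmless: the bound forces `ker G ⊆ ker J`.
  have hS : ∀ t, S ⟨G t, t, rfl⟩ = J t := fun t => by
    have h0 := h (s ⟨G t, t, rfl⟩ - t)
    rw [map_sub G, hs', sub_self, norm_zero, mul_zero, norm_le_zero_iff, map_sub, sub_eq_zero] at h0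
    exact h0
  obtain ⟨g, hg, hgn⟩ := exists_extension_norm_eq G.range ((innerSL ℝ f).comp S)
  refine ⟨(InnerProductSpace.toDual ℝ H).symm g, ?_, fun t => ?_⟩
  · rw [LinearIsometryEquiv.norm_map, hgn]
    refine (ContinuousLinearMap.opNorm_comp_le _ _).trans ?_
    rw [innerSL_apply_norm, mul_comm]
    exact mul_le_mul_of_nonneg_right (LinearMap.mkContinuous_norm_le _ hC _) (norm_nonneg _)
  · rw [InnerProductSpace.toDual_symm_apply, hg ⟨G t, t, rfl⟩]
    simp [hS]

/-! ### Test functions and the weak divergence -/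

variable {d : ℕ} {Ω : Opens (E d)}

/-- The gradient of a function on `ℝ^d`, as a vector field. -/
noncomputable def grad (φ : E d → ℝ) (x : E d) : E d :=
  WithLp.toLp 2 fun j => fderiv ℝ φ x (EuclideanSpace.single j 1)

theorem inner_grad (v : E d) (φ : E d → ℝ) (x : E d) :
    inner ℝ v (grad φ x) = ∑ j : Fin d, v j * fderiv ℝ φ x (EuclideanSpace.single j 1) := by
  simp [grad, PiLp.inner_apply, mul_comm]

theorem IsTestFunction.memLp_grad {φ : E d → ℝ} (hφ : IsTestFunction Ω φ) :
    MemLp (grad φ) 2 (volume.restrict (Ω : Set (E d))) := by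
  have hc : Continuous (fderiv ℝ φ) := hφ.smooth.continuous_fderiv (by simp)
  have hg : Continuous (grad φ) := (PiLp.continuous_toLp 2 _).comp
    (continuous_pi fun j => hc.clm_apply continuous_const)
  refine (hg.memLp_of_hasCompactSupport ((hφ.compact.fderiv ℝ).mono fun x hx h => hx ?_)).restrict _
  ext j
  simp [grad, h]

/-- The vector space of test functions on `Ω`. -/
def testFunctions (Ω : Opens (E d)) : Submodule ℝ (E d → ℝ) where
  carrier := {φ | IsTestFunction Ω φ}
  add_mem' {φ ψ} hφ hψ := ⟨hφ.smooth.add hψ.smooth, hφ.compact.add hψ.compact,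
    (tsupport_add φ ψ).trans (Set.union_subset hφ.support hψ.support)⟩
  zero_mem' := ⟨contDiff_const, HasCompactSupport.zero, by simp [tsupport]⟩
  smul_mem' c φ hφ := ⟨contDiff_const.smul hφ.smooth, hφ.compact.smul_left (f := fun _ => c),
    (closure_mono (Function.support_const_smul_subset c φ)).trans hφ.support⟩

theorem IsTestFunction.differentiable {φ : E d → ℝ} (hφ : IsTestFunction Ω φ) :
    Differentiable ℝ φ :=
  hφ.smooth.differentiable (by simp)

/-- The inclusion of the test functions in `L²(Ω)`. -/
noncomputable def testToL2 (Ω : Opens (E d)) : testFunctions Ω →ₗ[ℝ] L2 Ω where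
  toFun φ := MemLp.toLp φ.1 (IsTestFunction.memLp φ.2)
  map_add' φ ψ := MemLp.toLp_add (IsTestFunction.memLp φ.2) (IsTestFunction.memLp ψ.2)
  map_smul' c φ := MemLp.toLp_const_smul c (IsTestFunction.memLp φ.2)

/-- The gradient of test functions, with values in `L²(Ω)^d`. -/
noncomputable def testGrad (Ω : Opens (E d)) : testFunctions Ω →ₗ[ℝ] L2Vec Ω where
  toFun φ := MemLp.toLp (grad φ.1) (IsTestFunction.memLp_grad φ.2)
  map_add' φ ψ := by
    rw [← MemLp.toLp_add (IsTestFunction.memLp_grad φ.2) (IsTestFunction.memLp_grad ψ.2)]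
    congr 1
    ext x j
    simp [grad, fderiv_add (IsTestFunction.differentiable φ.2 x)
      (IsTestFunction.differentiable ψ.2 x)]
  map_smul' c φ := by
    rw [RingHom.id_apply, ← MemLp.toLp_const_smul c (IsTestFunction.memLp_grad φ.2)]
    congr 1
    ext x j
    simp [grad, fderiv_const_smul (IsTestFunction.differentiable φ.2 x)]

/-- Puts the weak divergence in the form that the representation lemma above produces. -/
theorem hasWeakDiv_iff_inner {q : L2Vec Ω} {g : L2 Ω} :
    HasWeakDiv Ω q g ↔
      ∀ φ : testFunctions Ω, inner ℝ q (testGrad Ω φ) = - inner ℝ g (testToL2 Ω φ) := by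
  have e1 : ∀ φ : testFunctions Ω, inner ℝ q (testGrad Ω φ) = ∫ x in (Ω : Set (E d)),
      ∑ j : Fin d, q x j * fderiv ℝ φ.1 x (EuclideanSpace.single j 1) := fun φ => by
    rw [L2.inner_def]
    refine integral_congr_ae ?_
    filter_upwards [MemLp.coeFn_toLp (IsTestFunction.memLp_grad φ.2)] with x hx
    rw [← inner_grad, ← hx]
    rfl
  have e2 : ∀ φ : testFunctions Ω, inner ℝ g (testToL2 Ω φ) =
      ∫ x in (Ω : Set (E d)), g x * φ.1 x := fun φ => by
    rw [L2.inner_def]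
    refine integral_congr_ae ?_
    filter_upwards [MemLp.coeFn_toLp (IsTestFunction.memLp φ.2)] with x hx
    rw [← hx]
    simp [testToL2, mul_comm]
  simp only [e1, e2]
  exact ⟨fun h φ => h φ.1 φ.2, fun h φ hφ => h ⟨φ, hφ⟩⟩

/-! ### Poincaré inequality -/

/-- The integral identity behind the Poincaré inequality. -/
theorem IsTestFunction.integral_sq {φ : E d → ℝ} (hφ : IsTestFunction Ω φ) (j : Fin d) :
    ∫ x in (Ω : Set (E d)), φ x ^ 2 = ∫ x in (Ω : Set (E d)),
      -(2 * x j) * (φ x * fderiv ℝ φ x (EuclideanSpace.single j 1)) := by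
  set e : E d := EuclideanSpace.single j 1
  have hz : ∀ x ∉ (Ω : Set (E d)), φ x = 0 := fun x hx => by
    by_contra hne
    exact hx (hφ.support (subset_tsupport φ hne))
  rw [setIntegral_eq_integral_of_forall_compl_eq_zero (fun x hx => by simp [hz x hx]),
    setIntegral_eq_integral_of_forall_compl_eq_zero (fun x hx => by simp [hz x hx])]
  have hd := hφ.differentiable
  have hcφ := hφ.smooth.continuous
  have hc : Continuous fun x => fderiv ℝ φ x e :=
    (hφ.smooth.continuous_fderiv (by simp)).clm_apply continuous_const
  have hx : Continuous fun x : E d => x j := (EuclideanSpace.proj (𝕜 := ℝ) j).continuous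
  have hsq : ∀ x, fderiv ℝ (fun y => φ y ^ 2) x e = 2 * (φ x * fderiv ℝ φ x e) := fun x => by
    have := ((hd x).hasFDerivAt.pow 2).fderiv
    rw [this]
    simp
    ring
  have hco : ∀ x, fderiv ℝ (fun y : E d => y j) x e = 1 := fun x => by
    have : fderiv ℝ (fun y : E d => y j) x = EuclideanSpace.proj (𝕜 := ℝ) j :=
      (EuclideanSpace.proj (𝕜 := ℝ) j).fderiv
    rw [this]
    simp [e]
  have hi : ∀ f : E d → ℝ, Continuous f → (∀ x, φ x = 0 → f x = 0) → Integrable f := fun f hf h0 =>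
    hf.integrable_of_hasCompactSupport (hφ.compact.mono fun x hx h => hx (h0 x h))
  -- Integrate `φ² = φ² ∂ⱼxⱼ` by parts; compact support leaves no boundary term.
  have key := integral_mul_fderiv_eq_neg_fderiv_mul_of_integrable (μ := volume)
    (f := fun y : E d => y j) (g := fun y => φ y ^ 2) (v := e) ?_ ?_ ?_
    (fun x _ => (EuclideanSpace.proj (𝕜 := ℝ) j).differentiable x) (fun x _ => hd.pow 2 x)
  · simp only [hsq, hco, one_mul] at key
    rw [← neg_neg (∫ x, φ x ^ 2), ← key, ← integral_neg]
    congr 1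
    ext x
    ring
  · simp only [hco, one_mul]
    exact hi _ (by fun_prop) fun x h => by simp [h]
  · simp only [hsq]
    exact hi _ (by fun_prop) fun x h => by simp [h]
  · exact hi _ (by fun_prop) fun x h => by simp [h]

/-- Poincaré inequality for test functions. -/
theorem norm_testToL2_le {R : ℝ} (hR : ∀ x ∈ (Ω : Set (E d)), ‖x‖ ≤ R) (hR0 : 0 ≤ R)
    (j : Fin d) (φ : testFunctions Ω) : ‖testToL2 Ω φ‖ ≤ 2 * R * ‖testGrad Ω φ‖ := by
  have hφ : IsTestFunction Ω φ.1 := φ.2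
  have hJ : ‖testToL2 Ω φ‖ ^ 2 = ∫ x in (Ω : Set (E d)), φ.1 x ^ 2 := by
    rw [← real_inner_self_eq_norm_sq, L2.inner_def]
    refine integral_congr_ae ?_
    filter_upwards [MemLp.coeFn_toLp hφ.memLp] with x hx
    have hx' : (testToL2 Ω φ) x = φ.1 x := hx
    rw [real_inner_self_eq_norm_sq, hx', Real.norm_eq_abs, sq_abs]
  have hG : ‖testGrad Ω φ‖ ^ 2 = ∫ x in (Ω : Set (E d)), ‖grad φ.1 x‖ ^ 2 := by
    rw [← real_inner_self_eq_norm_sq, L2.inner_def]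
    refine integral_congr_ae ?_
    filter_upwards [MemLp.coeFn_toLp hφ.memLp_grad] with x hx
    rw [← hx]
    exact real_inner_self_eq_norm_sq _
  have iJ : Integrable (fun x => φ.1 x ^ 2) (volume.restrict (Ω : Set (E d))) :=
    hφ.memLp.integrable_sq
  have iG : Integrable (fun x => ‖grad φ.1 x‖ ^ 2) (volume.restrict (Ω : Set (E d))) :=
    hφ.memLp_grad.norm.integrable_sq
  have key : ∫ x in (Ω : Set (E d)), φ.1 x ^ 2 ≤
      ∫ x in (Ω : Set (E d)), (1 / 2 * φ.1 x ^ 2 + 2 * R ^ 2 * ‖grad φ.1 x‖ ^ 2) := by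
    rw [hφ.integral_sq j]
    refine setIntegral_mono_on (Continuous.integrable_of_hasCompactSupport ?_ ?_).integrableOn
      ((iJ.const_mul _).add (iG.const_mul _)) Ω.isOpen.measurableSet fun x hx => ?_
    · have := hφ.smooth.continuous
      have : Continuous fun x => fderiv ℝ φ.1 x (EuclideanSpace.single j 1) :=
        (hφ.smooth.continuous_fderiv (by simp)).clm_apply continuous_const
      fun_prop
    · exact hφ.compact.mono fun x hx h => hx (by simp [h])
    · have hxj : |x j| ≤ R := (PiLp.norm_apply_le x j).trans (hR x hx)
      have hgj : |fderiv ℝ φ.1 x (EuclideanSpace.single j 1)| ≤ ‖grad φ.1 x‖ :=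
        PiLp.norm_apply_le (grad φ.1 x) j
      have hm : |x j * fderiv ℝ φ.1 x (EuclideanSpace.single j 1)| ≤ R * ‖grad φ.1 x‖ := by
        rw [abs_mul]
        gcongr
      have hsq := sq_le_sq' (abs_le.1 hm).1 (abs_le.1 hm).2
      -- Young's inequality, weighted so that only half of `φ²` appears on the right and can be
      -- absorbed.
      nlinarith [sq_nonneg (φ.1 x + 2 * (x j * fderiv ℝ φ.1 x (EuclideanSpace.single j 1)))]
  rw [integral_add (iJ.const_mul _) (iG.const_mul _), integral_const_mul, integral_const_mul,
    ← hJ, ← hG] at key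
  refine abs_le_of_sq_le_sq' ?_ (by positivity) |>.2
  nlinarith

/-! ### Surjectivity of the divergence -/

/-- On a bounded open set the divergence has a bounded right inverse. -/
theorem exists_div_eq (hd : 1 ≤ d) (hΩ : Bornology.IsBounded (Ω : Set (E d))) :
    ∃ C : ℝ, 0 ≤ C ∧ ∀ f : L2 Ω, ∃ q : HDiv Ω, div q = f ∧ ‖(q : L2Vec Ω)‖ ≤ C * ‖f‖ := by
  obtain ⟨R, hR0, hR⟩ := hΩ.exists_pos_norm_le
  refine ⟨2 * R, by positivity, fun f => ?_⟩
  obtain ⟨q, hq, hqf⟩ := exists_inner_eq_of_norm_le (testGrad Ω) (testToL2 Ω)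
    (by positivity : 0 ≤ 2 * R) (norm_testToL2_le hR hR0.le ⟨0, hd⟩) (-f)
  have hw : HasWeakDiv Ω q f := hasWeakDiv_iff_inner.2 fun φ => by rw [hqf, inner_neg_left]
  exact ⟨⟨q, f, hw⟩, HasWeakDiv.unique (hasWeakDiv_div _) hw, by simpa using hq⟩

/-! ### The form, the norm and coercivity -/

theorem γ_apply (ξ η : V Ω) : γ Ω ξ η = inner ℝ (ξ.2 : L2Vec Ω) (η.2 : L2Vec Ω)
    + inner ℝ ξ.1 (div η.2) + inner ℝ (div ξ.2) η.1 := rfl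

theorem γ_comm (ξ η : V Ω) : γ Ω ξ η = γ Ω η ξ := by
  rw [γ_apply, γ_apply, real_inner_comm, real_inner_comm (div η.2), real_inner_comm η.1]
  ring

theorem normV_nonneg (η : V Ω) : 0 ≤ normV η := Real.sqrt_nonneg _

theorem normV_sq (η : V Ω) :
    normV η ^ 2 = ‖η.1‖ ^ 2 + ‖(η.2 : L2Vec Ω)‖ ^ 2 + ‖div η.2‖ ^ 2 := by
  rw [normV, normDiv, Real.sq_sqrt (by positivity), Real.sq_sqrt (by positivity), add_assoc]

theorem normV_smul (c : ℝ) (η : V Ω) : normV (c • η) = |c| * normV η := by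
  rw [← sq_eq_sq₀ (normV_nonneg _) (mul_nonneg (abs_nonneg c) (normV_nonneg _)), mul_pow,
    normV_sq, normV_sq]
  simp only [Prod.smul_fst, Prod.smul_snd, Submodule.coe_smul, map_smul, norm_smul,
    Real.norm_eq_abs, mul_pow]
  ring

theorem normV_pos {η : V Ω} (hη : η ≠ 0) : 0 < normV η := by
  refine (normV_nonneg η).lt_of_ne fun h => hη ?_
  have h2 := normV_sq η
  rw [← h] at h2
  have h1 : ‖η.1‖ = 0 := by nlinarith [sq_nonneg ‖(η.2 : L2Vec Ω)‖, sq_nonneg ‖div η.2‖]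
  have h3 : ‖(η.2 : L2Vec Ω)‖ = 0 := by nlinarith [sq_nonneg ‖η.1‖, sq_nonneg ‖div η.2‖]
  exact Prod.ext (norm_eq_zero.1 h1) (Subtype.ext (norm_eq_zero.1 h3))

/-- Every `ξ` has a partner of comparable norm on which `γ` is coercive. -/
theorem exists_le_γ (hd : 1 ≤ d) (hΩ : Bornology.IsBounded (Ω : Set (E d))) :
    ∃ c M : ℝ, 0 < c ∧ 0 < M ∧
      ∀ ξ : V Ω, ∃ η : V Ω, normV η ≤ M * normV ξ ∧ c * normV ξ ^ 2 ≤ γ Ω ξ η := by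
  obtain ⟨C, hC, h⟩ := exists_div_eq hd hΩ
  -- Ensures both `t ≤ 1` and `t C² ≤ 1`, even when `C = 0`.
  set t : ℝ := 1 / (C ^ 2 + 1) with ht
  have ht0 : 0 < t := by positivity
  have htC : t * (C ^ 2 + 1) = 1 := by rw [ht]; field_simp
  have ht1 : t ≤ 1 := by nlinarith [mul_nonneg ht0.le (sq_nonneg C)]
  have htC2 : t * C ^ 2 ≤ 1 := by linarith
  refine ⟨t / 2, 4 + C, by positivity, by positivity, fun ξ => ?_⟩
  obtain ⟨w, hw, hwn⟩ := h ξ.1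
  obtain ⟨u, p⟩ := ξ
  -- The `-u` cancels `(u, div p)`, `div p` yields `‖div p‖²`, and `t w` yields `t ‖u‖²` at the cost
  -- of the cross term `t (p, w)`.
  refine ⟨(div p - u, p + t • w), ?_, ?_⟩
  · have hn := normV_sq (u, p)
    have h0 := normV_nonneg (u, p)
    have hu : ‖u‖ ≤ normV (u, p) :=
      abs_le_of_sq_le_sq' (by rw [hn]; nlinarith [sq_nonneg ‖(p : L2Vec Ω)‖, sq_nonneg ‖div p‖]) h0 |>.2
    have hp : ‖(p : L2Vec Ω)‖ ≤ normV (u, p) :=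
      abs_le_of_sq_le_sq' (by rw [hn]; nlinarith [sq_nonneg ‖u‖, sq_nonneg ‖div p‖]) h0 |>.2
    have hdp : ‖div p‖ ≤ normV (u, p) :=
      abs_le_of_sq_le_sq' (by rw [hn]; nlinarith [sq_nonneg ‖(p : L2Vec Ω)‖, sq_nonneg ‖u‖]) h0 |>.2
    have h1 : ‖div p - u‖ ≤ 2 * normV (u, p) := (norm_sub_le _ _).trans (by linarith)
    have htw : ‖t • (w : L2Vec Ω)‖ ≤ C * normV (u, p) := by
      rw [norm_smul, Real.norm_of_nonneg ht0.le]
      calc t * ‖(w : L2Vec Ω)‖ ≤ 1 * ‖(w : L2Vec Ω)‖ := by gcongr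
        _ ≤ C * ‖u‖ := by rw [one_mul]; exact hwn
        _ ≤ C * normV (u, p) := by gcongr
    have h2 : ‖((p + t • w : HDiv Ω) : L2Vec Ω)‖ ≤ (1 + C) * normV (u, p) :=
      (norm_add_le _ _).trans (by
        rw [add_mul, one_mul]
        exact add_le_add hp htw)
    have h3 : ‖div (p + t • w)‖ ≤ 2 * normV (u, p) := by
      rw [map_add, map_smul, hw]
      refine (norm_add_le _ _).trans ?_
      rw [norm_smul, Real.norm_of_nonneg ht0.le]
      nlinarith [norm_nonneg u]
    refine abs_le_of_sq_le_sq' ?_ (by positivity) |>.2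
    rw [normV_sq]
    calc _ ≤ (2 * normV (u, p)) ^ 2 + ((1 + C) * normV (u, p)) ^ 2 + (2 * normV (u, p)) ^ 2 := by
          gcongr
      _ = (8 + (1 + C) ^ 2) * normV (u, p) ^ 2 := by ring
      _ ≤ (4 + C) ^ 2 * normV (u, p) ^ 2 := by
          gcongr
          nlinarith
      _ = _ := by ring
  · have e : γ Ω (u, p) (div p - u, p + t • w) = ‖(p : L2Vec Ω)‖ ^ 2
        + t * inner ℝ (p : L2Vec Ω) (w : L2Vec Ω) + t * ‖u‖ ^ 2 + ‖div p‖ ^ 2 := by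
      rw [γ_apply]
      simp only [Submodule.coe_add, Submodule.coe_smul, map_add, map_smul, hw, inner_add_right,
        inner_sub_right, real_inner_smul_right, real_inner_self_eq_norm_sq, real_inner_comm u]
      ring
    have hb : -(‖(p : L2Vec Ω)‖ * (C * ‖u‖)) ≤ inner ℝ (p : L2Vec Ω) (w : L2Vec Ω) :=
      (neg_le_neg (mul_le_mul_of_nonneg_left hwn (norm_nonneg _))).trans
        (abs_le.1 (abs_real_inner_le_norm _ _)).1
    rw [e, normV_sq]
    have h1 := mul_le_mul_of_nonneg_left hb ht0.le
    have h2 : t * (t * C ^ 2 * ‖u‖ ^ 2) ≤ t * ‖u‖ ^ 2 := by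
      gcongr
      nlinarith [sq_nonneg ‖u‖]
    -- Young: `t C ‖p‖ ‖u‖ ≤ ‖p‖²/2 + t² C² ‖u‖²/2`, whose last term is at most `t ‖u‖²/2`.
    nlinarith [sq_nonneg (‖(p : L2Vec Ω)‖ - t * C * ‖u‖), sq_nonneg ‖(p : L2Vec Ω)‖,
      sq_nonneg ‖div p‖, mul_nonneg (sub_nonneg.2 ht1) (sq_nonneg ‖(p : L2Vec Ω)‖),
      mul_nonneg (sub_nonneg.2 ht1) (sq_nonneg ‖div p‖)]

end MixedPoisson

theorem proposition1 {d : ℕ} (hd : 1 ≤ d)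
    (Ω : TopologicalSpace.Opens (EuclideanSpace ℝ (Fin d)))
    (hΩ : Bornology.IsBounded (Ω : Set (EuclideanSpace ℝ (Fin d)))) :
    (∃ β : ℝ, 0 < β ∧
      (β : EReal) ≤ ⨅ ξ ∈ {ξ : MixedPoisson.V Ω | MixedPoisson.normV ξ = 1},
        ⨆ η ∈ {η : MixedPoisson.V Ω | MixedPoisson.normV η ≤ 1},
          ((MixedPoisson.γ Ω ξ η : ℝ) : EReal)) ∧
    (∀ η : MixedPoisson.V Ω, η ≠ 0 →
      ⨆ ξ : MixedPoisson.V Ω, ((MixedPoisson.γ Ω ξ η : ℝ) : EReal) = ⊤) := by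
  obtain ⟨c, M, hc, hM, h⟩ := MixedPoisson.exists_le_γ hd hΩ
  refine ⟨⟨M⁻¹ * c, by positivity, le_iInf₂ fun ξ hξ => ?_⟩, fun η hη => ?_⟩
  · obtain ⟨η, hn, hγ⟩ := h ξ
    have hξ1 : MixedPoisson.normV ξ = 1 := hξ
    rw [hξ1] at hn hγ
    refine le_iSup₂_of_le (M⁻¹ • η) ?_ (EReal.coe_le_coe_iff.2 ?_)
    · change MixedPoisson.normV (M⁻¹ • η) ≤ 1
      rw [MixedPoisson.normV_smul, abs_of_pos (inv_pos.2 hM), inv_mul_le_iff₀ hM]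
      exact hn
    · rw [map_smul, smul_eq_mul]
      exact mul_le_mul_of_nonneg_left (by linarith) (inv_pos.2 hM).le
  · obtain ⟨ξ, -, hγ⟩ := h η
    have hpos : 0 < MixedPoisson.γ Ω ξ η := by
      rw [MixedPoisson.γ_comm]
      exact (mul_pos hc (pow_pos (MixedPoisson.normV_pos hη) 2)).trans_le hγ
    rw [EReal.eq_top_iff_forall_lt]
    intro y
    -- Rescale `ξ` so that `γ` takes the value `y + 1`.
    refine lt_of_lt_of_le (EReal.coe_lt_coe_iff.2 (lt_add_one y))
      (le_iSup_of_le (((y + 1) / MixedPoisson.γ Ω ξ η) • ξ) (EReal.coe_le_coe_iff.2 ?_))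
    rw [map_smul, LinearMap.smul_apply, smul_eq_mul, div_mul_cancel₀ _ hpos.ne']
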